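/- Let $p$ be a prime, $G$ a finite group and $(K,\mathcal{O},F)$ a splitting $p$-modular system for $G$: $\mathcal{O}$ is a complete discrete valuation ring with quotient field $K$ of characteristic $0$ and residue field $F$ of characteristic $p$, and $K$ and $F$ are splitting fields for $G$. Let $B$ be a block of the group algebra $FG$, that is, $B = bFG$ for a primitive idempotent $b$ of the center of $FG$. Let $k(B)$ be the number of irreducible ordinary characters of $G$ (characters of irreducible representations over $K$) that belong to $B$, i.e. on whose representations the central idempotent of $\mathcal{O}G$ lifting $b$ acts as the identity. Let $C_B = (c_{ST})$ be the Cartan matrix of $B$: here $S, T$ range over the isomorphism classes of irreducible right $B$-modules and $c_{ST}$ is the multiplicity of $T$ as a composition factor of the projective cover $P_S$ of $S$. Then \[ k(B) \le \operatorname{tr} C_B . \] -/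

import Mathlib

open scoped MonoidAlgebra

noncomputable section

namespace BlockTheory

section Modules

/-! ### Composition multiplicities, projective covers and the Cartan matrix of an artinian ring

Modules over a ring `R` are left modules; a right `B`-module is a module over `Bᵐᵒᵖ`. -/

/-- The number of factors of the composition series `s` that are isomorphic to `S`. -/
def factorCount {R : Type*} [Ring R] {M : Type*} [AddCommGroup M] [Module R M]
    (s : CompositionSeries (Submodule R M)) (S : Type*) [AddCommGroup S] [Module R S] : ℕ :=
  Nat.card {i : Fin s.length //
    Nonempty ((s i.succ ⧸ (s i.castSucc).submoduleOf (s i.succ)) ≃ₗ[R] S)}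

/-- The number of factors isomorphic to `S` is the same for all composition series of `M`. -/
theorem factorCount_eq {R : Type*} [Ring R] {M : Type*} [AddCommGroup M] [Module R M]
    (s t : CompositionSeries (Submodule R M)) (hb : s.head = t.head) (ht : s.last = t.last)
    (S : Type*) [AddCommGroup S] [Module R S] : factorCount s S = factorCount t S := by
  obtain ⟨f, hf⟩ := CompositionSeries.jordan_holder s t hb ht
  refine Nat.card_congr (f.subtypeEquiv fun i => ?_)
  have e : (s i.succ ⧸ (s i.castSucc).submoduleOf (s i.succ)) ≃ₗ[R]
      (t (f i).succ ⧸ (t (f i).castSucc).submoduleOf (t (f i).succ)) :=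
    JordanHolderLattice.Iso.linearEquiv (hf i)
  exact ⟨fun ⟨g⟩ => ⟨e.symm.trans g⟩, fun ⟨g⟩ => ⟨e.trans g⟩⟩

open Classical in
/-- The multiplicity of the simple module `S` as a composition factor of the module `M` of finite
length, computed along any composition series of `M` (and `0` if `M` has none). -/
def compositionMultiplicity (R : Type*) [Ring R] (M : Type*) [AddCommGroup M] [Module R M]
    (S : Type*) [AddCommGroup S] [Module R S] : ℕ :=
  if h : ∃ s : CompositionSeries (Submodule R M), s.head = ⊥ ∧ s.last = ⊤ then
    factorCount h.choose S
  else 0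

/-- `π : P → M` is a projective cover of `M`: the module `P` is projective, `π` is surjective, and
no proper submodule of `P` together with `ker π` generates `P`. -/
structure IsProjectiveCover {R : Type*} [Ring R] {P M : Type*} [AddCommGroup P] [Module R P]
    [AddCommGroup M] [Module R M] (π : P →ₗ[R] M) : Prop where
  projective : Module.Projective R P
  surjective : Function.Surjective π
  superfluous : ∀ N : Submodule R P, N ⊔ LinearMap.ker π = ⊤ → N = ⊤

/-- Isomorphism of the simple modules `R ⧸ I`, `I` a maximal left ideal. -/
instance simpleSetoid (R : Type*) [Ring R] : Setoid {I : Submodule R R // IsCoatom I} where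
  r I J := Nonempty ((R ⧸ I.1) ≃ₗ[R] (R ⧸ J.1))
  iseqv := ⟨fun _ => ⟨LinearEquiv.refl R _⟩, fun ⟨e⟩ => ⟨e.symm⟩, fun ⟨e⟩ ⟨f⟩ => ⟨e.trans f⟩⟩

/-- The isomorphism classes of simple `R`-modules. Every simple `R`-module is isomorphic to `R ⧸ I`
for some maximal left ideal `I`. -/
def SimpleClass (R : Type*) [Ring R] : Type _ :=
  Quotient (simpleSetoid R)

/-- A simple module in the isomorphism class `S`. -/
abbrev SimpleClass.toModule {R : Type*} [Ring R] (S : SimpleClass R) : Type _ :=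
  R ⧸ (Quotient.out S).1

/-- Over an artinian ring every simple module has a projective cover. -/
theorem exists_projectiveCover {R : Type*} [Ring R] [IsArtinianRing R] (I : Submodule R R)
    (hI : IsCoatom I) :
    ∃ (P : Submodule R R) (π : P →ₗ[R] (R ⧸ I)), IsProjectiveCover π := by
  have : IsSimpleModule R (R ⧸ I) := isSimpleModule_iff_isCoatom.mpr hI
  obtain ⟨P, hP, hmin⟩ := WellFounded.has_min (wellFounded_lt (α := Submodule R R))
    {P : Submodule R R | P.map I.mkQ = ⊤} ⟨⊤, by simp⟩
  have hP' : P.map I.mkQ = ⊤ := hP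
  have hsurj : Function.Surjective (I.mkQ.comp P.subtype) := by
    rw [← LinearMap.range_eq_top, LinearMap.range_comp, Submodule.range_subtype, hP']
  -- a submodule of `P` that maps onto the simple module is all of `P`
  have hmin' : ∀ N : Submodule R P, N.map (I.mkQ.comp P.subtype) = ⊤ → N = ⊤ := by
    intro N hN
    rw [Submodule.map_comp] at hN
    have h1 : N.map P.subtype ≤ P := Submodule.map_subtype_le P N
    have h2 : N.map P.subtype = P := by
      by_contra hne
      exact hmin _ hN (lt_of_le_of_ne h1 hne)
    apply Submodule.map_injective_of_injective P.injective_subtype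
    rw [h2, Submodule.map_top, Submodule.range_subtype]
  obtain ⟨φ, hφ⟩ := Module.projective_lifting_property (I.mkQ.comp P.subtype) I.mkQ hsurj
  have hψ : Function.Surjective (φ.comp P.subtype) := by
    rw [← LinearMap.range_eq_top]
    apply hmin'
    rw [← LinearMap.range_comp, ← LinearMap.comp_assoc, hφ]
    exact LinearMap.range_eq_top.mpr hsurj
  have hbij : Function.Bijective (φ.comp P.subtype) :=
    IsNoetherian.bijective_of_surjective_endomorphism _ hψ
  let e := LinearEquiv.ofBijective _ hbij
  refine ⟨P, I.mkQ.comp P.subtype, ?_, hsurj, ?_⟩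
  · refine Module.Projective.of_split (M := R) (P.subtype.comp e.symm.toLinearMap) φ ?_
    exact LinearMap.ext fun x => e.apply_symm_apply x
  · intro N hN
    apply hmin'
    have := congrArg (Submodule.map (I.mkQ.comp P.subtype)) hN
    have hk : (LinearMap.ker (I.mkQ.comp P.subtype)).map (I.mkQ.comp P.subtype) = ⊥ :=
      (Submodule.map_le_iff_le_comap.mpr le_rfl).antisymm bot_le
    rw [Submodule.map_sup, hk, sup_bot_eq, Submodule.map_top] at this
    rw [this]
    exact LinearMap.range_eq_top.mpr hsurj

/-- An artinian ring has finitely many simple modules up to isomorphism. -/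
instance finite_simpleClass (R : Type*) [Ring R] [IsArtinianRing R] : Finite (SimpleClass R) := by
  obtain ⟨s, hs0, hs1⟩ :=
    exists_compositionSeries_of_isNoetherian_isArtinian (R := R) (M := R)
  -- every simple module is isomorphic to a factor of the composition series `s` of `R`
  have key : ∀ I : Submodule R R, IsCoatom I → ∃ i : Fin s.length,
      Nonempty ((s i.succ ⧸ (s i.castSucc).submoduleOf (s i.succ)) ≃ₗ[R] (R ⧸ I)) := by
    intro I hI
    obtain ⟨i, hi0, hi1⟩ : ∃ i : Fin s.length, s i.castSucc ≤ I ∧ ¬ s i.succ ≤ I := by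
      by_contra! hcon
      have hall : ∀ j : Fin (s.length + 1), s j ≤ I := by
        intro j
        induction j using Fin.induction with
        | zero =>
          have : s 0 = ⊥ := hs0
          rw [this]
          exact bot_le
        | succ j ih => exact hcon j ih
      have hlast : (⊤ : Submodule R R) ≤ I := hs1 ▸ hall (Fin.last _)
      exact hI.1 (top_le_iff.mp hlast)
    have hcov : s i.castSucc ⋖ s i.succ := s.step i
    have hinf : s i.castSucc = s i.succ ⊓ I := by
      refine ((hcov.eq_or_eq (le_inf hcov.le hi0) inf_le_left).resolve_right ?_).symm
      exact fun h => hi1 (inf_eq_left.mp h)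
    have hsup : s i.succ ⊔ I = ⊤ :=
      hI.2 _ (lt_of_le_of_ne le_sup_right fun h => hi1 (h ▸ le_sup_left))
    have hsurj : Function.Surjective (I.mkQ.comp (s i.succ).subtype) := by
      rw [← LinearMap.range_eq_top, LinearMap.range_comp, Submodule.range_subtype]
      have := congrArg (Submodule.map I.mkQ) hsup
      rwa [Submodule.map_sup, Submodule.mkQ_map_self, sup_bot_eq, Submodule.map_top,
        Submodule.range_mkQ] at this
    have hker : (s i.castSucc).submoduleOf (s i.succ) =
        LinearMap.ker (I.mkQ.comp (s i.succ).subtype) := by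
      rw [LinearMap.ker_comp, Submodule.ker_mkQ, hinf]
      ext x
      simp [Submodule.submoduleOf]
    exact ⟨i, ⟨(Submodule.quotEquivOfEq _ _ hker).trans
      (LinearMap.quotKerEquivOfSurjective _ hsurj)⟩⟩
  choose f hf using key
  refine Finite.of_injective
    (fun S : SimpleClass R => f (Quotient.out S).1 (Quotient.out S).2) fun S T hST => ?_
  obtain ⟨e⟩ := hf (Quotient.out S).1 (Quotient.out S).2
  obtain ⟨e'⟩ := hf (Quotient.out T).1 (Quotient.out T).2
  dsimp only at hST
  rw [← hST] at e'
  rw [← Quotient.out_eq S, ← Quotient.out_eq T]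
  exact Quotient.sound ⟨e.symm.trans e'⟩

instance (R : Type*) [Ring R] [IsArtinianRing R] : Fintype (SimpleClass R) :=
  Fintype.ofFinite _

/-- The projective cover of a simple module in the class `S`. -/
abbrev SimpleClass.projectiveCover {R : Type*} [Ring R] [IsArtinianRing R] (S : SimpleClass R) :
    Type _ :=
  (exists_projectiveCover (Quotient.out S).1 (Quotient.out S).2).choose

/-- The Cartan matrix of an artinian ring: its entry at `(S, T)` is the multiplicity of `T` as a
composition factor of the projective cover of `S`. -/
def cartanMatrix (R : Type*) [Ring R] [IsArtinianRing R] :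
    Matrix (SimpleClass R) (SimpleClass R) ℕ :=
  Matrix.of fun S T => compositionMultiplicity R S.projectiveCover T.toModule

end Modules

section Blocks

/-! ### Blocks of a group algebra -/

/-- `b` is a block idempotent of `A`, that is, a primitive idempotent of the centre of `A`. -/
structure IsBlockIdempotent {A : Type*} [Ring A] (b : A) : Prop where
  idem : IsIdempotentElem b
  central : b ∈ Subring.center A
  ne_zero : b ≠ 0
  primitive : ∀ c : A, IsIdempotentElem c → c ∈ Subring.center A → b * c = c → c = 0 ∨ c = b

/-- The block `bA = bAb` with block idempotent `b`; it is a ring with identity element `b`. -/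
abbrev BlockAlgebra {A : Type*} [Ring A] {b : A} (hb : IsBlockIdempotent b) : Type _ :=
  hb.idem.Corner

/-- The projection `A → bA`, `a ↦ bab = ba`. -/
def toBlock {A : Type*} [Ring A] {b : A} (hb : IsBlockIdempotent b) : A →+* BlockAlgebra hb where
  toFun a := ⟨b * a * b, a, rfl⟩
  map_one' := Subtype.ext (by
    change b * 1 * b = b
    rw [mul_one, hb.idem.eq])
  map_zero' := Subtype.ext (by
    change b * 0 * b = 0
    simp)
  map_add' x y := Subtype.ext (by
    change b * (x + y) * b = b * x * b + b * y * b
    rw [mul_add, add_mul])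
  map_mul' x y := Subtype.ext (by
    change b * (x * y) * b = b * x * b * (b * y * b)
    have h : ∀ z, z * b = b * z := Subring.mem_center_iff.mp hb.central
    have hbb := hb.idem.eq
    calc b * (x * y) * b = b * x * (b * y) := by rw [mul_assoc, mul_assoc, h]; simp [mul_assoc]
      _ = b * x * (b * b * b * y) := by rw [hbb, hbb]
      _ = b * x * b * (b * y * b) := by rw [mul_assoc b y b, h y]; simp [mul_assoc])

theorem toBlock_surjective {A : Type*} [Ring A] {b : A} (hb : IsBlockIdempotent b) :
    Function.Surjective (toBlock hb) := by
  rintro ⟨_, a, rfl⟩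
  exact ⟨a, rfl⟩

/-- A block of a finite group algebra over a field is a right artinian ring. -/
instance isArtinianRing_blockAlgebra_op {k : Type*} [Field k] {G : Type*} [Group G] [Finite G]
    {b : k[G]} (hb : IsBlockIdempotent b) : IsArtinianRing (BlockAlgebra hb)ᵐᵒᵖ := by
  have : Module.Finite k (k[G])ᵐᵒᵖ :=
    Module.Finite.equiv (MulOpposite.opLinearEquiv k : k[G] ≃ₗ[k] (k[G])ᵐᵒᵖ)
  have : IsArtinianRing (k[G])ᵐᵒᵖ := IsArtinianRing.of_finite k _
  refine Function.Surjective.isArtinianRing (f := (toBlock hb).op) ?_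
  intro x
  obtain ⟨a, ha⟩ := toBlock_surjective hb x.unop
  exact ⟨MulOpposite.op a, MulOpposite.unop_injective ha⟩

/-- `k` is a splitting field for `G`: the only endomorphisms of an irreducible representation of
`G` over `k` are the scalars. -/
def IsSplittingFieldFor (k : Type*) [Field k] (G : Type*) [Group G] : Prop :=
  ∀ (n : ℕ) (ρ : Representation k G (Fin n → k)), ρ.IsIrreducible →
    Function.Bijective (algebraMap k (Representation.IntertwiningMap ρ ρ))

/-- The representation `ρ` over `K` belongs to the block with block idempotent `b` of the group
algebra over the residue field of `O`: the central idempotent of `O[G]` that lifts `b` acts as the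
identity. (For complete `O` there is exactly one such lift.) -/
def BelongsToBlock (O : Type*) [CommRing O] [IsLocalRing O] {K : Type*} [Field K] [Algebra O K]
    {G : Type*} [Group G] {V : Type*} [AddCommGroup V] [Module K V]
    (b : (IsLocalRing.ResidueField O)[G]) (ρ : Representation K G V) : Prop :=
  ∃ c : O[G], IsIdempotentElem c ∧ c ∈ Subring.center O[G] ∧
    MonoidAlgebra.mapRingHom G (IsLocalRing.residue O) c = b ∧
    ρ.asAlgebraHom (MonoidAlgebra.mapRingHom G (algebraMap O K) c) = 1

/-- The set of irreducible ordinary characters in the block with block idempotent `b`; its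
cardinality is the number `k(B)`. -/
def blockCharacters (O : Type*) [CommRing O] [IsLocalRing O] (K : Type*) [Field K] [Algebra O K]
    {G : Type*} [Group G] (b : (IsLocalRing.ResidueField O)[G]) : Set (G → K) :=
  {χ | ∃ (n : ℕ) (ρ : Representation K G (Fin n → K)),
    ρ.IsIrreducible ∧ BelongsToBlock O b ρ ∧ ρ.character = χ}

end Blocks

end BlockTheory

end

/-!
# The number of ordinary characters of a block is at most the trace of its Cartan matrix

Let `S` run over the simple right modules of the block `B`. The projective cover of `S` is `e_S B`
for an idempotent `e_S`. Since `F` is a splitting field, the multiplicity of `S` in a module `M` is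
the dimension of `Hom(e_S B, M)`, so the Cartan invariant `c_SS` is at least the dimension of the
corner `e_S B e_S` (`IsProjectiveCover.rank_hom_le`, `exists_idempotents_cartanMatrix`,
`exists_block_idempotents`).

As `O` is complete, `e_S` lifts to an idempotent `e` of `O[G]` by Newton's method
(`exists_idempotent_lift`), and the lattice `e O[G] e` has rank at most the dimension of its
reduction `e_S B e_S` (`exists_linearIndependent_corner`). The irreducible representations over `K`
on which `e` is non-zero contribute linearly independent elements to this lattice: `K[G]` is
semisimple, so there are elements acting as the identity on one of them and as zero on the others;
multiply these by `e` on both sides and clear denominators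
(`exists_linearIndependent_of_integralHom_ne_zero`). Hence `c_SS` is at least the number of
characters on which the lift of `e_S` does not vanish.

Finally, every character of the block is counted for some `S`
(`BelongsToBlock.exists_integralHom_ne_zero`). The `e_S` generate the block as a two-sided ideal; if
their lifts all acted as zero on a representation in the block, then the central idempotent that
lifts `b`, which acts as the identity, would act as `ϖ` times an element of `O[G]`, with `ϖ` a
uniformizer of `O`. That element would act as `ϖ⁻¹`, which is not integral over `O`.
-/

open BlockTheory

/-! ### Projective covers and Cartan invariants -/

section ProjectiveCover

variable {R P S T : Type*} [Ring R] [AddCommGroup P] [Module R P] [AddCommGroup S] [Module R S]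
  [AddCommGroup T] [Module R T]

/-- The kernel of a projective cover of a simple module is the only maximal submodule. -/
theorem BlockTheory.IsProjectiveCover.ker_eq_of_surjective {π : P →ₗ[R] S}
    (hπ : IsProjectiveCover π) [IsSimpleModule R S] [IsSimpleModule R T] {f : P →ₗ[R] T}
    (hf : Function.Surjective f) : LinearMap.ker f = LinearMap.ker π := by
  have h1 : IsCoatom (LinearMap.ker f) := LinearMap.isCoatom_ker_of_surjective hf
  have h2 : IsCoatom (LinearMap.ker π) := LinearMap.isCoatom_ker_of_surjective hπ.surjective
  by_contra hne
  exact h1.1 (hπ.superfluous _ (h1.sup_eq_top_of_ne h2 hne))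

/-- A non-zero map from the projective cover of a simple module `S` to a simple module factors
through an isomorphism with `S`. -/
theorem BlockTheory.IsProjectiveCover.exists_comp_eq {π : P →ₗ[R] S}
    (hπ : IsProjectiveCover π) [IsSimpleModule R S] [IsSimpleModule R T] {f : P →ₗ[R] T}
    (hf : f ≠ 0) : ∃ φ : S ≃ₗ[R] T, f = φ.toLinearMap ∘ₗ π := by
  have hs : Function.Surjective f := f.surjective_of_ne_zero hf
  have hk := hπ.ker_eq_of_surjective hs
  refine ⟨(π.quotKerEquivOfSurjective hπ.surjective).symm.trans
    ((Submodule.quotEquivOfEq _ _ hk.symm).trans (f.quotKerEquivOfSurjective hs)), ?_⟩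
  ext x
  have : (π.quotKerEquivOfSurjective hπ.surjective).symm (π x) = Submodule.Quotient.mk x := by
    rw [LinearEquiv.symm_apply_eq]; rfl
  simp [this]

variable (F : Type*) [Field F] [Algebra F R] [Module F T] [IsScalarTower F R T]
  [Module F S] [IsScalarTower F R S]

open Classical in
/-- `dim Hom(P, T)` is at most one if `T ≅ S`, and zero otherwise, when `P` is the projective
cover of the simple module `S` and the endomorphisms of `S` are the scalars. -/
theorem BlockTheory.IsProjectiveCover.rank_hom_simple_le {π : P →ₗ[R] S}
    (hπ : IsProjectiveCover π) [IsSimpleModule R S] [IsSimpleModule R T]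
    (hS : ∀ f : S →ₗ[R] S, ∃ a : F, ∀ x, f x = a • x) :
    Module.rank F (P →ₗ[R] T) ≤ if Nonempty (T ≃ₗ[R] S) then 1 else 0 := by
  by_cases h0 : ∃ f : P →ₗ[R] T, f ≠ 0
  · obtain ⟨f, hf⟩ := h0
    obtain ⟨φ, hφ⟩ := hπ.exists_comp_eq hf
    rw [if_pos ⟨φ.symm⟩]
    refine rank_le_one_iff.mpr ⟨f, fun g => ?_⟩
    by_cases hg : g = 0
    · exact ⟨0, by simp [hg]⟩
    obtain ⟨ψ, hψ⟩ := hπ.exists_comp_eq hg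
    obtain ⟨a, ha⟩ := hS (φ.symm.toLinearMap ∘ₗ ψ.toLinearMap)
    refine ⟨a, ?_⟩
    ext x
    have := congrArg φ (ha (π x))
    rw [hφ, hψ]
    have h2 : φ (a • π x) = a • φ (π x) := by
      rw [← algebraMap_smul R a, map_smul, algebraMap_smul]
    simp at this
    simp [this, h2]
  · push Not at h0
    have : Subsingleton (P →ₗ[R] T) := ⟨fun f g => by rw [h0 f, h0 g]⟩
    rw [rank_subsingleton']
    exact zero_le

end ProjectiveCover

/-- Left exactness of `Hom(P, -)` bounds the dimension of `Hom(P, N')` for `N ≤ N'`. -/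
theorem rank_hom_le_add_rank_hom_quotient (F : Type*) {R P M : Type*} [Field F] [Ring R]
    [Algebra F R] [AddCommGroup P] [Module R P] [AddCommGroup M] [Module R M] [Module F M]
    [IsScalarTower F R M] (N N' : Submodule R M) :
    Module.rank F (P →ₗ[R] N') ≤
      Module.rank F (P →ₗ[R] (N' ⧸ N.submoduleOf N')) + Module.rank F (P →ₗ[R] N) := by
  let φ : (P →ₗ[R] N') →ₗ[F] (P →ₗ[R] (N' ⧸ N.submoduleOf N')) :=
    { toFun := fun f => (N.submoduleOf N').mkQ ∘ₗ f
      map_add' := fun f g => by ext; simp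
      map_smul' := fun a f => by ext; simp }
  have hmem : ∀ f : LinearMap.ker φ, ∀ x, ((f : P →ₗ[R] N') x : M) ∈ N := by
    intro f x
    have := LinearMap.congr_fun (LinearMap.mem_ker.mp f.2) x
    exact (Submodule.Quotient.mk_eq_zero (N.submoduleOf N')).mp this
  let ψ : LinearMap.ker φ →ₗ[F] (P →ₗ[R] N) :=
    { toFun := fun f => (N'.subtype ∘ₗ f.1).codRestrict N (hmem f)
      map_add' := fun f g => rfl
      map_smul' := fun a f => rfl }
  have hψ : Function.Injective ψ := by
    intro f g h
    ext x
    exact congrArg (Subtype.val : N → M) (LinearMap.congr_fun h x)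
  rw [← φ.rank_range_add_rank_ker]
  exact add_le_add (Submodule.rank_le _) (LinearMap.rank_le_of_injective ψ hψ)

/-- The dimension of `Hom(P, M)` is at most the multiplicity of `S` as a composition factor of
`M`, when `P` is the projective cover of the simple module `S`. -/
theorem BlockTheory.IsProjectiveCover.rank_hom_le (F : Type*) {R P S M : Type*} [Field F] [Ring R]
    [Algebra F R] [AddCommGroup P] [Module R P] [AddCommGroup S] [Module R S] [Module F S]
    [IsScalarTower F R S] [AddCommGroup M] [Module R M] [Module F M] [IsScalarTower F R M]
    [IsSimpleModule R S] {π : P →ₗ[R] S} (hπ : IsProjectiveCover π)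
    (hS : ∀ f : S →ₗ[R] S, ∃ a : F, ∀ x, f x = a • x)
    (hM : ∃ s : CompositionSeries (Submodule R M), s.head = ⊥ ∧ s.last = ⊤) :
    Module.rank F (P →ₗ[R] M) ≤ compositionMultiplicity R M S := by
  classical
  rw [compositionMultiplicity, dif_pos hM]
  obtain ⟨h0, h1⟩ := hM.choose_spec
  set s := hM.choose
  let t : Fin s.length → ℕ := fun i =>
    if Nonempty ((s i.succ ⧸ (s i.castSucc).submoduleOf (s i.succ)) ≃ₗ[R] S) then 1 else 0
  have key : ∀ j : Fin (s.length + 1), Module.rank F (P →ₗ[R] s j) ≤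
      ((∑ i with i.castSucc < j, t i : ℕ) : Cardinal) := by
    intro j
    induction j using Fin.induction with
    | zero =>
      have h : s 0 = ⊥ := h0
      have : Subsingleton (P →ₗ[R] s 0) := by
        rw [h]; infer_instance
      rw [rank_subsingleton']
      exact zero_le
    | succ j ih =>
      have hsim : IsSimpleModule R (s j.succ ⧸ (s j.castSucc).submoduleOf (s j.succ)) :=
        (covBy_iff_quot_is_simple (s.step j).le).mp (s.step j)
      have e : ({i : Fin s.length | i.castSucc < j.succ} : Finset _) =
          insert j ({i : Fin s.length | i.castSucc < j.castSucc} : Finset _) := by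
        ext i
        simp only [Finset.mem_filter_univ, Finset.mem_insert, Fin.castSucc_lt_castSucc_iff,
          Fin.castSucc_lt_succ_iff]
        exact le_iff_eq_or_lt
      rw [e, Finset.sum_insert (by simp), Nat.cast_add]
      refine (rank_hom_le_add_rank_hom_quotient F (s j.castSucc) (s j.succ)).trans
        (add_le_add ?_ ih)
      refine (hπ.rank_hom_simple_le F hS).trans (le_of_eq ?_)
      simp only [t]
      split_ifs <;> simp
  have hlast := key (Fin.last _)
  have hs : s (Fin.last _) = ⊤ := h1
  rw [hs] at hlast
  let ι : (P →ₗ[R] M) →ₗ[F] (P →ₗ[R] (⊤ : Submodule R M)) :=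
    { toFun := fun f => f.codRestrict ⊤ fun _ => trivial
      map_add' := fun f g => rfl
      map_smul' := fun a f => rfl }
  have hι : Function.Injective ι := by
    intro f g h
    ext x
    exact congrArg Subtype.val (LinearMap.congr_fun h x)
  refine (LinearMap.rank_le_of_injective ι hι).trans (hlast.trans ?_)
  rw [Nat.cast_le, factorCount, Nat.card_eq_fintype_card, Fintype.card_subtype,
    Finset.card_filter]
  exact Finset.sum_le_sum_of_subset (Finset.filter_subset _ _)

/-- The projective cover `P` of a simple module is isomorphic to `R e` for an idempotent `e`: a
generator `x` of `P` with `e x = x` corresponds to `e`. -/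
theorem BlockTheory.IsProjectiveCover.exists_idempotent {R P S : Type*} [Ring R] [AddCommGroup P]
    [Module R P] [AddCommGroup S] [Module R S] [IsSimpleModule R S] {π : P →ₗ[R] S}
    (hπ : IsProjectiveCover π) :
    ∃ (e : R) (x : P) (s : P →ₗ[R] R), s x = e ∧ e • x = x ∧ π x ≠ 0 ∧ e * e = e := by
  have := IsSimpleModule.nontrivial R S
  obtain ⟨y, hy⟩ := exists_ne (0 : S)
  obtain ⟨x, rfl⟩ := hπ.surjective y
  -- `x` generates `P` because it generates `P` modulo the superfluous submodule `ker π`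
  have htop : Submodule.span R {x} = ⊤ := by
    apply hπ.superfluous
    rw [eq_top_iff]
    intro z _
    obtain ⟨r, hr⟩ := IsSimpleModule.toSpanSingleton_surjective R hy (π z)
    rw [Submodule.mem_sup]
    refine ⟨r • x, Submodule.smul_mem _ _ (Submodule.mem_span_singleton_self x), z - r • x, ?_,
      by abel⟩
    simp at hr
    simp [hr]
  have hsurj : Function.Surjective (LinearMap.toSpanSingleton R P x) := by
    rw [← LinearMap.range_eq_top, LinearMap.range_toSpanSingleton, htop]
  have := hπ.projective
  obtain ⟨s, hs⟩ := Module.projective_lifting_property (LinearMap.toSpanSingleton R P x)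
    LinearMap.id hsurj
  have hx : s x • x = x := by simpa using LinearMap.congr_fun hs x
  refine ⟨s x, x, s, rfl, hx, hy, ?_⟩
  rw [← smul_eq_mul, ← map_smul, hx]

/-- Idempotents `e S` attached to the simple modules `S` of a split finite-dimensional algebra
`R`: the corner `e S * R * e S` has dimension at most the Cartan invariant at `(S, S)`, and the
`e S` generate `R` as a two-sided ideal. -/
theorem exists_idempotents_cartanMatrix (F : Type*) {R : Type*} [Field F] [Ring R]
    [IsArtinianRing R] [Algebra F R]
    (hR : ∀ (I : Submodule R R), IsCoatom I → ∀ f : (R ⧸ I) →ₗ[R] (R ⧸ I),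
      ∃ a : F, ∀ x, f x = a • x) :
    ∃ e : SimpleClass R → R, (∀ S, e S * e S = e S) ∧
      (∀ S (d : ℕ) (v : Fin d → R), LinearIndependent F v → (∀ i, e S * v i * e S = v i) →
        d ≤ cartanMatrix R S S) ∧
      ∀ L : Submodule R R, (∀ S r, e S * r ∈ L) → L = ⊤ := by
  have key : ∀ S : SimpleClass R, ∃ e : R, e * e = e ∧
      (∀ (d : ℕ) (v : Fin d → R), LinearIndependent F v → (∀ i, e * v i * e = v i) →
        d ≤ cartanMatrix R S S) ∧ ∃ y : S.toModule, e • y ≠ 0 := by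
    intro S
    obtain ⟨π, hπ⟩ := (exists_projectiveCover (Quotient.out S).1 (Quotient.out S).2).choose_spec
    have : IsSimpleModule R (R ⧸ (Quotient.out S).1) :=
      isSimpleModule_iff_isCoatom.mpr (Quotient.out S).2
    obtain ⟨e, x, s, hsx, hex, hx0, hee⟩ := hπ.exists_idempotent
    refine ⟨e, hee, ?_, π x, by rwa [← map_smul, hex]⟩
    intro d v hv hve
    -- `p ↦ s p * a * x` is an endomorphism of `P`, which determines `a` in `e R e`
    let Φ : R →ₗ[F] (S.projectiveCover →ₗ[R] S.projectiveCover) :=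
      { toFun := fun a => LinearMap.toSpanSingleton R _ (a • x) ∘ₗ s
        map_add' := fun a b => by ext; simp [add_smul]
        map_smul' := fun c a => by ext; simp }
    have hΦ : ∀ a, s (Φ a x) = e * a * e := fun a => by
      simp [Φ, hsx, mul_assoc]
    have hΦv : LinearIndependent F (fun i => Φ (v i)) := by
      rw [Fintype.linearIndependent_iff] at hv ⊢
      intro g hg
      apply hv g
      have h1 : Φ (∑ i, g i • v i) = 0 := by simpa using hg
      have h2 := hΦ (∑ i, g i • v i)
      rw [h1] at h2
      simp only [LinearMap.zero_apply, map_zero, Finset.mul_sum, Finset.sum_mul,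
        mul_smul_comm, smul_mul_assoc, hve] at h2
      exact h2.symm
    have h1 := hΦv.cardinal_lift_le_rank
    have h2 := hπ.rank_hom_le F (M := S.projectiveCover) (hR _ (Quotient.out S).2)
      (exists_compositionSeries_of_isNoetherian_isArtinian R _)
    have h3 := h1.trans (Cardinal.lift_le.mpr h2)
    simp only [Cardinal.mk_fin, Cardinal.lift_natCast, Nat.cast_le] at h3
    exact h3
  choose e he hv y hy using key
  -- a proper left ideal containing all `e S * r` lies in a maximal one `I`; but then `e S` kills
  -- `R ⧸ I` for all `S`, in particular for the class of `R ⧸ I`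
  refine ⟨e, he, hv, fun L hL => ?_⟩
  by_contra hne
  obtain ⟨I, hI, hLI⟩ := (eq_top_or_exists_le_coatom L).resolve_left hne
  let S : SimpleClass R := Quotient.mk _ ⟨I, hI⟩
  obtain ⟨φ⟩ : Nonempty (S.toModule ≃ₗ[R] (R ⧸ I)) := Quotient.exact (Quotient.out_eq S)
  apply hy S
  apply φ.injective
  obtain ⟨r, hr⟩ := I.mkQ_surjective (φ (y S))
  rw [map_smul, map_zero, ← hr, ← map_smul]
  exact (Submodule.Quotient.mk_eq_zero I).mpr (hLI (hL S r))

/-! ### Lifting idempotents -/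

section Idempotents

variable {O : Type*} [CommRing O] {A : Type*} [Ring A] [Algebra O A]

/-- Precompleteness passes to finite modules `M`, because `AdicCompletion I O ⊗ M` maps onto the
completion of `M`. -/
theorem IsPrecomplete.of_finite (I : Ideal O) [IsPrecomplete I O]
    (M : Type*) [AddCommGroup M] [Module O M] [Module.Finite O M] : IsPrecomplete I M := by
  rw [← AdicCompletion.of_surjective_iff]
  intro x
  obtain ⟨t, rfl⟩ := AdicCompletion.ofTensorProduct_surjective_of_finite I M x
  rw [← LinearMap.mem_range]
  induction t with
  | zero => simp
  | add a b ha hb => rw [map_add]; exact add_mem ha hb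
  | tmul r m =>
    obtain ⟨s, rfl⟩ := AdicCompletion.of_surjective I O r
    refine ⟨s • m, ?_⟩
    rw [AdicCompletion.ofTensorProduct_tmul]
    ext n
    rfl

theorem mem_span_singleton_pow_smul_top {ϖ : O} {n : ℕ} {M : Type*} [AddCommGroup M] [Module O M]
    {x : M} : x ∈ (Ideal.span {ϖ} ^ n • ⊤ : Submodule O M) ↔ ∃ y, x = ϖ ^ n • y := by
  rw [Ideal.span_singleton_pow, Submodule.ideal_span_singleton_smul,
    Submodule.mem_smul_pointwise_iff_exists]
  simp [eq_comm]

/-- One step `x ↦ 3x² - 2x³` of Newton's method for the equation `x² = x`. -/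
theorem exists_newton_idempotent {ϖ : O} {x y : A} {n : ℕ} (h : x * x - x = ϖ ^ (n + 1) • y) :
    (∃ w, 3 * (x * x) - 2 * (x * x * x) - x = ϖ ^ (n + 1) • w) ∧
    ∃ z, (3 * (x * x) - 2 * (x * x * x)) * (3 * (x * x) - 2 * (x * x * x)) -
      (3 * (x * x) - 2 * (x * x * x)) = ϖ ^ (n + 2) • z := by
  constructor
  · refine ⟨y * (1 - 2 * x), ?_⟩
    rw [← smul_mul_assoc, ← h]
    noncomm_ring
  · refine ⟨ϖ ^ n • (y * y * (4 * (x * x - x) - 3)), ?_⟩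
    have : ϖ ^ (n + 2) • ϖ ^ n • (y * y * (4 * (x * x - x) - 3)) =
        (ϖ ^ (n + 1) • y) * (ϖ ^ (n + 1) • y) * (4 * (x * x - x) - 3) := by
      rw [smul_mul_smul_comm, smul_mul_assoc, smul_smul]
      congr 1
      ring
    rw [this, ← h]
    noncomm_ring

/-- Idempotents lift along reduction modulo `ϖ` in a finite algebra over a ring that is complete
with respect to `ϖ`. -/
theorem exists_idempotent_lift [IsNoetherianRing O] [Module.Finite O A] (ϖ : O)
    [IsAdicComplete (Ideal.span {ϖ}) O] {a y : A} (ha : a * a - a = ϖ • y) :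
    ∃ e : A, e * e = e ∧ ∃ z, e = a + ϖ • z := by
  have hpre : IsPrecomplete (Ideal.span {ϖ}) A := IsPrecomplete.of_finite _ A
  have hhaus : IsHausdorff (Ideal.span {ϖ}) A :=
    IsHausdorff.of_le_jacobson _ _ (IsAdicComplete.le_jacobson_bot _)
  -- the quadratic convergence of the iteration is not needed: gaining one power of `ϖ` per step is
  -- enough
  let f : ℕ → A := fun n => (fun x => 3 * (x * x) - 2 * (x * x * x))^[n] a
  have hf : ∀ n, f (n + 1) = 3 * (f n * f n) - 2 * (f n * f n * f n) := fun n =>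
    Function.iterate_succ_apply' _ _ _
  have hidem : ∀ n, ∃ y, f n * f n - f n = ϖ ^ (n + 1) • y := by
    intro n
    induction n with
    | zero => exact ⟨y, by rw [zero_add, pow_one]; exact ha⟩
    | succ n ih =>
      obtain ⟨y, hy⟩ := ih
      rw [hf]
      exact (exists_newton_idempotent hy).2
  have hstep : ∀ n, ∃ w, f (n + 1) - f n = ϖ ^ (n + 1) • w := by
    intro n
    obtain ⟨y, hy⟩ := hidem n
    rw [hf]
    exact (exists_newton_idempotent hy).1
  have hcauchy : ∀ {k m n}, k ≤ m + 1 → m ≤ n → ∃ w, f n - f m = ϖ ^ k • w := by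
    intro k m n hk hmn
    induction n, hmn using Nat.le_induction with
    | base => exact ⟨0, by simp⟩
    | succ n hmn ih =>
      obtain ⟨w, hw⟩ := ih
      obtain ⟨w', hw'⟩ := hstep n
      refine ⟨w + ϖ ^ (n + 1 - k) • w', ?_⟩
      rw [smul_add, smul_smul, ← pow_add, Nat.add_sub_cancel' (by omega), ← hw, ← hw']
      abel
  obtain ⟨L, hL⟩ := hpre.prec (f := f) fun {m n} hmn => by
    rw [SModEq.comm, SModEq.sub_mem, mem_span_singleton_pow_smul_top]
    exact hcauchy (Nat.le_succ m) hmn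
  have hL' : ∀ n, ∃ w, L = f n + ϖ ^ n • w := by
    intro n
    obtain ⟨w, hw⟩ := mem_span_singleton_pow_smul_top.mp (SModEq.sub_mem.mp (hL n).symm)
    exact ⟨w, by rw [← hw]; abel⟩
  refine ⟨L, sub_eq_zero.mp (hhaus.haus _ fun n => ?_), ?_⟩
  · rw [SModEq.zero, mem_span_singleton_pow_smul_top]
    obtain ⟨w, hw⟩ := hL' n
    obtain ⟨y, hy⟩ := hidem n
    refine ⟨ϖ • y + (f n * w + w * f n + ϖ ^ n • (w * w) - w), ?_⟩
    rw [smul_add, smul_smul, ← pow_succ, ← hy, hw]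
    simp only [mul_add, add_mul, smul_add, smul_sub, smul_mul_assoc, mul_smul_comm]
    abel
  · obtain ⟨w, hw⟩ := hL' 1
    obtain ⟨w', hw'⟩ := hcauchy (k := 1) (m := 0) (n := 1) le_rfl zero_le_one
    refine ⟨w' + w, ?_⟩
    rw [pow_one] at hw hw'
    rw [hw, smul_add, ← hw']
    change f 1 + _ = f 0 + _
    abel

end Idempotents

/-! ### Reduction of corners of the integral group ring -/

section Reduction

variable {O : Type*} [CommRing O] [IsLocalRing O] {G : Type*}

theorem MonoidAlgebra.mapRingHom_surjective [Monoid G] {R S : Type*} [Semiring R] [Semiring S]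
    {f : R →+* S} (hf : Function.Surjective f) :
    Function.Surjective (MonoidAlgebra.mapRingHom G f) := by
  intro x
  induction x using MonoidAlgebra.induction_linear with
  | zero => exact ⟨0, map_zero _⟩
  | add x y hx hy =>
    obtain ⟨a, rfl⟩ := hx
    obtain ⟨b, rfl⟩ := hy
    exact ⟨a + b, map_add _ _ _⟩
  | single g r =>
    obtain ⟨s, rfl⟩ := hf r
    exact ⟨single g s, by simp⟩

theorem MonoidAlgebra.mapRingHom_smul [Monoid G] {R S : Type*} [Semiring R] [Semiring S]
    (f : R →+* S) (r : R) (x : R[G]) :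
    MonoidAlgebra.mapRingHom G f (r • x) = f r • MonoidAlgebra.mapRingHom G f x := by
  ext g
  simp

theorem MonoidAlgebra.mapRingHom_residue_eq_zero_iff [Monoid G] {ϖ : O}
    (hϖ : IsLocalRing.maximalIdeal O = Ideal.span {ϖ}) (x : O[G]) :
    MonoidAlgebra.mapRingHom G (IsLocalRing.residue O) x = 0 ↔ ∃ y, x = ϖ • y := by
  constructor
  · intro h
    have h1 : ∀ g, ∃ r, x.coeff g = ϖ * r := by
      intro g
      have : IsLocalRing.residue O (x.coeff g) = 0 := by
        rw [← MonoidAlgebra.coeff_mapRingHom, h]; simp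
      rw [IsLocalRing.residue_eq_zero_iff, hϖ, Ideal.mem_span_singleton] at this
      exact this
    choose r hr using h1
    refine ⟨∑ g ∈ x.coeff.support, MonoidAlgebra.single g (r g), ?_⟩
    classical
    ext g
    by_cases hg : x.coeff g = 0 <;> simp [Finsupp.single_apply, hr]
  · rintro ⟨y, rfl⟩
    have : IsLocalRing.residue O ϖ = 0 := by
      rw [IsLocalRing.residue_eq_zero_iff, hϖ]
      exact Ideal.mem_span_singleton_self ϖ
    rw [mapRingHom_smul, this, zero_smul]

/-- For an idempotent `e` of `O[G]`, an `O`-basis `w` of the lattice `e O[G] e` stays independent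
modulo the maximal ideal. Hence an independent family in the lattice has at most as many members
as there are independent elements in the corner of the reduction of `e`. -/
theorem exists_linearIndependent_corner [IsDomain O] [IsPrincipalIdealRing O] [Group G] [Finite G]
    {e : O[G]} (he : e * e = e) :
    ∃ (d : ℕ) (w : Fin d → O[G]), (∀ i, e * w i * e = w i) ∧
      LinearIndependent (IsLocalRing.ResidueField O)
        (fun i => MonoidAlgebra.mapRingHom G (IsLocalRing.residue O) (w i)) ∧
      ∀ {ι : Type*} [Fintype ι] (v : ι → O[G]), LinearIndependent O v →
        (∀ i, e * v i * e = v i) → Fintype.card ι ≤ d := by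
  obtain ⟨ϖ, hϖ⟩ := (IsPrincipalIdealRing.principal (IsLocalRing.maximalIdeal O)).principal
  let M : Submodule O O[G] :=
    { carrier := {x | e * x * e = x}
      add_mem' := fun {x y} hx hy => by
        simp only [Set.mem_ofPred_eq] at hx hy ⊢
        rw [mul_add, add_mul, hx, hy]
      zero_mem' := by simp
      smul_mem' := fun r x hx => by
        simp only [Set.mem_ofPred_eq] at hx ⊢
        rw [mul_smul_comm, smul_mul_assoc, hx] }
  have hM : ∀ x, x ∈ M ↔ e * x * e = x := fun x => Iff.rfl
  let B := Module.finBasis O M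
  refine ⟨_, fun i => (B i : O[G]), fun i => (B i).2, ?_, ?_⟩
  · rw [Fintype.linearIndependent_iff]
    intro g hg
    choose r hr using fun i => IsLocalRing.residue_surjective (R := O) (g i)
    have h1 : MonoidAlgebra.mapRingHom G (IsLocalRing.residue O)
        (∑ i, r i • (B i : O[G])) = 0 := by
      rw [map_sum, ← hg]
      exact Finset.sum_congr rfl fun i _ => by
        rw [MonoidAlgebra.mapRingHom_smul, hr]
    obtain ⟨y, hy⟩ := (MonoidAlgebra.mapRingHom_residue_eq_zero_iff hϖ _).mp h1
    -- `ϖ y` lies in the corner, so `y` may be replaced by `e y e`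
    have hy' : e * y * e ∈ M := by
      rw [hM]
      calc e * (e * y * e) * e = (e * e) * y * (e * e) := by noncomm_ring
        _ = e * y * e := by rw [he]
    have h2 : ∑ i, r i • B i = ϖ • (⟨e * y * e, hy'⟩ : M) := by
      have h3 := (hM _).mp (∑ i, r i • B i).2
      apply Subtype.ext
      rw [← h3]
      have : ((∑ i, r i • B i : M) : O[G]) = ϖ • y := by rw [← hy]; simp
      rw [this]
      simp
    intro i
    have h3 := congrArg (fun m => B.repr m i) h2
    simp only [B.repr_sum_self, map_smul, Finsupp.smul_apply, smul_eq_mul] at h3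
    rw [← hr i, h3, IsLocalRing.residue_eq_zero_iff, hϖ]
    exact Ideal.mem_span_singleton.mpr (dvd_mul_right _ _)
  · intro ι _ v hv hve
    have : LinearIndependent O (fun i => (⟨v i, hve i⟩ : M)) :=
      LinearIndependent.of_comp M.subtype hv
    exact this.fintype_card_le_finrank

end Reduction

/-! ### Separating simple modules -/

/-- Pairwise non-isomorphic simple modules over a semisimple ring are separated by ring elements:
some `z` acts as the identity on the `i`-th one and as zero on the others. -/
theorem exists_smul_eq_of_pairwise_not_iso {A ι : Type*} [Ring A] [IsSemisimpleRing A]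
    {V : ι → Type*} [∀ i, AddCommGroup (V i)] [∀ i, Module A (V i)]
    [∀ i, IsSimpleModule A (V i)] (hV : ∀ i j, i ≠ j → IsEmpty (V i ≃ₗ[A] V j)) (i : ι) :
    ∃ z : A, (∀ x : V i, z • x = x) ∧ ∀ j, j ≠ i → ∀ x : V j, z • x = 0 := by
  let I : Submodule A A := Module.annihilator A (V i)
  have hI : ∀ a, a ∈ I ↔ ∀ x : V i, a • x = 0 := fun a => Module.mem_annihilator
  obtain ⟨L, hL⟩ := exists_isCompl I
  -- `z` is the component of `1` in a complement `L` of the annihilator of `V i`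
  obtain ⟨u, hu, z, hz, huz⟩ := Submodule.mem_sup.mp
    (hL.sup_eq_top ▸ Submodule.mem_top : (1 : A) ∈ I ⊔ L)
  refine ⟨z, fun x => ?_, fun j hj x => ?_⟩
  · have := congrArg (· • x) huz
    simpa [add_smul, (hI u).mp hu x] using this
  · by_contra hne
    -- otherwise `V j` is a quotient of `L`, hence embeds into `L`; composing with
    -- evaluations at elements of `V i` shows that the image lies in the annihilator `I` of `V i`
    let f : L →ₗ[A] V j := (LinearMap.toSpanSingleton A (V j) x) ∘ₗ L.subtype
    have hf : f ≠ 0 := fun h => hne (LinearMap.congr_fun h ⟨z, hz⟩)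
    have := Module.projective_of_isSemisimpleRing A (V j)
    obtain ⟨g, hg⟩ := Module.projective_lifting_property f LinearMap.id (f.surjective_of_ne_zero hf)
    have hx : x ≠ 0 := fun h => hne (by rw [h, smul_zero])
    apply hx
    have h0 : (g x : A) ∈ I := by
      rw [hI]
      intro w
      have := LinearMap.bijective_or_eq_zero
        ((LinearMap.toSpanSingleton A (V i) w) ∘ₗ L.subtype ∘ₗ g)
      rcases this with h | h
      · exact ((hV j i hj).false (LinearEquiv.ofBijective _ h)).elim
      · exact LinearMap.congr_fun h x
    have h1 : g x = 0 := Subtype.ext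
      ((Submodule.disjoint_def.mp hL.disjoint) _ h0 (g x).2)
    have := LinearMap.congr_fun hg x
    simpa [h1] using this.symm

/-! ### Simple modules and idempotents of a block -/

/-- If the image of `G` spans the algebra `R` over a splitting field `k` of `G`, then the
endomorphisms of a simple `R`-module are the scalars. -/
theorem BlockTheory.IsSplittingFieldFor.exists_eq_smul {k G R V : Type*} [Field k] [Group G]
    (hk : IsSplittingFieldFor k G) [Ring R] [Algebra k R] [Module.Finite k R] (σ : G →* R)
    (hσ : Submodule.span k (Set.range σ) = ⊤) [AddCommGroup V] [Module R V] [Module k V]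
    [IsScalarTower k R V] [IsSimpleModule R V] (f : V →ₗ[R] V) : ∃ a : k, ∀ x, f x = a • x := by
  have : Module.Finite k V := Module.Finite.trans R V
  have := IsSimpleModule.nontrivial R V
  let β := (Module.finBasis k V).equivFun
  let ρ : Representation k G (Fin (Module.finrank k V) → k) :=
    { toFun := fun g => β.conj (Algebra.lsmul k k V (σ g))
      map_one' := by ext; simp
      map_mul' := fun g h => by ext; simp }
  have hρ : ∀ g x, ρ g (β x) = β (σ g • x) := fun g x => by simp [ρ]
  have hirr : ρ.IsIrreducible :=
    { exists_pair_ne := by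
        obtain ⟨x, hx⟩ := exists_ne (0 : V)
        refine ⟨⊥, ⊤, fun h => hx ?_⟩
        have h1 : β x ∈ (⊤ : Subrepresentation ρ) := Submodule.mem_top
        rw [← h] at h1
        exact β.map_eq_zero_iff.mp h1
      eq_bot_or_eq_top := fun W => by
        let W' : Submodule R V :=
          { carrier := {x | β x ∈ W.toSubmodule}
            add_mem' := fun {x y} hx hy => by
              rw [Set.mem_ofPred_eq, map_add]
              exact add_mem hx hy
            zero_mem' := by simp
            smul_mem' := fun r x hx => by
              have hr : r ∈ Submodule.span k (Set.range σ) := hσ ▸ Submodule.mem_top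
              rw [Set.mem_ofPred_eq]
              induction hr using Submodule.span_induction with
              | mem r h =>
                obtain ⟨g, rfl⟩ := h
                rw [← hρ]
                exact W.apply_mem_toSubmodule g hx
              | zero => simp
              | add r s _ _ hr hs =>
                rw [add_smul, map_add]
                exact add_mem hr hs
              | smul a r _ hr =>
                rw [smul_assoc, map_smul]
                exact W.toSubmodule.smul_mem a hr }
        have hW : ∀ x, x ∈ W' ↔ β x ∈ W.toSubmodule := fun x => Iff.rfl
        have hW2 : ∀ y, y ∈ W.toSubmodule ↔ β.symm y ∈ W' := fun y => by
          rw [hW, β.apply_symm_apply]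
        rcases eq_bot_or_eq_top W' with h | h
        · left
          apply Subrepresentation.toSubmodule_injective
          ext y
          rw [hW2, h, Submodule.mem_bot, β.symm.map_eq_zero_iff]
          rfl
        · right
          apply Subrepresentation.toSubmodule_injective
          ext y
          rw [hW2, h]
          exact ⟨fun _ => trivial, fun _ => trivial⟩ }
  let f' : Representation.IntertwiningMap ρ ρ :=
    ⟨β.conj (f.restrictScalars k), fun g => by ext; simp [ρ]⟩
  obtain ⟨a, ha⟩ := (hk _ ρ hirr).2 f'
  refine ⟨a, fun x => β.injective ?_⟩
  have h1 : algebraMap k (Representation.IntertwiningMap ρ ρ) a (β x) = f' (β x) := by rw [ha]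
  have h2 : f' (β x) = β (f x) := by
    change β.conj (f.restrictScalars k) (β x) = _
    simp
  rw [← h2, ← h1, map_smul]
  rfl

section Block

variable {k G : Type*} [Field k] [Group G] {b : k[G]} (hb : IsBlockIdempotent b)

theorem BlockTheory.toBlock_val (a : k[G]) : (toBlock hb a).1 = b * a * b := rfl

/-- A block of `k[G]` is an algebra over `k`. -/
noncomputable instance BlockTheory.blockAlgebra_algebra : Algebra k (BlockAlgebra hb) :=
  RingHom.toAlgebra' ((toBlock hb).comp (algebraMap k k[G])) fun c x => by
    obtain ⟨a, rfl⟩ := toBlock_surjective hb x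
    rw [RingHom.comp_apply, ← map_mul, ← map_mul, Algebra.commutes]

/-- The projection of the group algebra onto a block is a homomorphism of algebras. -/
noncomputable def BlockTheory.toBlockAlgHom : k[G] →ₐ[k] BlockAlgebra hb :=
  { toBlock hb with commutes' := fun _ => rfl }

theorem BlockTheory.toBlock_smul (c : k) (a : k[G]) : toBlock hb (c • a) = c • toBlock hb a :=
  map_smul (toBlockAlgHom hb) c a

theorem BlockTheory.blockAlgebra_smul_val (c : k) (x : BlockAlgebra hb) :
    (c • x).1 = c • x.1 := by
  obtain ⟨a, rfl⟩ := toBlock_surjective hb x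
  rw [← toBlock_smul, toBlock_val, toBlock_val, mul_smul_comm, smul_mul_assoc]

/-- The homomorphism from `G` to the opposite of a block that turns right modules over the
block into representations: `g` acts as right multiplication by `g⁻¹`. -/
noncomputable def BlockTheory.groupToBlockOp : G →* (BlockAlgebra hb)ᵐᵒᵖ where
  toFun g := MulOpposite.op (toBlock hb (MonoidAlgebra.of k G g⁻¹))
  map_one' := by rw [inv_one, map_one, map_one, MulOpposite.op_one]
  map_mul' g h := by rw [mul_inv_rev, map_mul, map_mul, MulOpposite.op_mul]

theorem BlockTheory.span_range_groupToBlockOp :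
    Submodule.span k (Set.range (groupToBlockOp hb)) = ⊤ := by
  rw [eq_top_iff]
  intro r _
  obtain ⟨a, ha⟩ := toBlock_surjective hb r.unop
  obtain rfl : MulOpposite.op (toBlock hb a) = r := by rw [ha]; rfl
  clear ha
  induction a using MonoidAlgebra.induction_linear with
  | zero => simp
  | add x y hx hy =>
    rw [map_add, MulOpposite.op_add]
    exact add_mem (hx trivial) (hy trivial)
  | single g c =>
    have : MonoidAlgebra.single g c = c • MonoidAlgebra.of k G g := by simp
    rw [this, toBlock_smul, MulOpposite.op_smul]
    exact Submodule.smul_mem _ _ (Submodule.subset_span ⟨g⁻¹, by simp [groupToBlockOp]⟩)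

/-- Over a splitting field there are idempotents `f S` of the block, attached to the simple right
modules `S`, whose corners have dimension at most the diagonal Cartan invariants, and which are
not all contained in a proper two-sided ideal of the block. -/
theorem BlockTheory.exists_block_idempotents [Finite G] (hk : IsSplittingFieldFor k G) :
    ∃ f : SimpleClass (BlockAlgebra hb)ᵐᵒᵖ → k[G], (∀ S, f S * f S = f S) ∧
      (∀ S (d : ℕ) (v : Fin d → k[G]), LinearIndependent k v → (∀ i, f S * v i * f S = v i) →
        d ≤ cartanMatrix (BlockAlgebra hb)ᵐᵒᵖ S S) ∧
      ∀ J : TwoSidedIdeal k[G], (∀ S, f S ∈ J) → b ∈ J := by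
  have hfin : Module.Finite k (BlockAlgebra hb) :=
    Module.Finite.of_surjective (toBlockAlgHom hb).toLinearMap (toBlock_surjective hb)
  have : Module.Finite k (BlockAlgebra hb)ᵐᵒᵖ :=
    Module.Finite.equiv (MulOpposite.opLinearEquiv k)
  obtain ⟨e, he, hdim, hgen⟩ := exists_idempotents_cartanMatrix k
    (R := (BlockAlgebra hb)ᵐᵒᵖ) fun I hI φ => by
      have : IsSimpleModule _ (_ ⧸ I) := isSimpleModule_iff_isCoatom.mpr hI
      exact hk.exists_eq_smul (groupToBlockOp hb) (span_range_groupToBlockOp hb) φ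
  refine ⟨fun S => (e S).unop.1, fun S => ?_, fun S d v hv hve => ?_, fun J hJ => ?_⟩
  · exact congrArg (fun x => x.unop.1) (he S)
  · let ι : (BlockAlgebra hb)ᵐᵒᵖ →ₗ[k] k[G] :=
      { toFun := fun x => x.unop.1
        map_add' := fun _ _ => rfl
        map_smul' := fun c x => blockAlgebra_smul_val hb c x.unop }
    obtain ⟨hbe, heb⟩ := (Subsemigroup.mem_corner_iff hb.idem).mp (e S).unop.2
    have hval : ∀ i, (toBlock hb (v i)).1 = v i := fun i => by
      rw [toBlock_val, ← hve i]
      simp only [mul_assoc, heb]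
      simp only [← mul_assoc, hbe]
    refine hdim S d (fun i => MulOpposite.op (toBlock hb (v i))) ?_ fun i => ?_
    · refine LinearIndependent.of_comp ι ?_
      have : ι ∘ (fun i => MulOpposite.op (toBlock hb (v i))) = v := funext hval
      rwa [this]
    · apply MulOpposite.unop_injective
      apply Subtype.ext
      change (e S).unop.1 * ((toBlock hb (v i)).1 * (e S).unop.1) = (toBlock hb (v i)).1
      rw [hval, ← mul_assoc, hve]
  · let L : Submodule (BlockAlgebra hb)ᵐᵒᵖ (BlockAlgebra hb)ᵐᵒᵖ :=
      { carrier := {x | x.unop.1 ∈ J}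
        add_mem' := fun hx hy => J.add_mem hx hy
        zero_mem' := J.zero_mem
        smul_mem' := fun r x hx => J.mul_mem_right x.unop.1 r.unop.1 hx }
    have hL : L = ⊤ := hgen L fun S r => J.mul_mem_left r.unop.1 _ (hJ S)
    have h1 : (1 : (BlockAlgebra hb)ᵐᵒᵖ) ∈ L := hL ▸ Submodule.mem_top
    exact h1

end Block

/-! ### Ordinary representations of the integral group ring -/

section Ordinary

variable {O : Type*} [CommRing O] {K : Type*} [Field K] [Algebra O K]
  {G : Type*} [Group G] {V : Type*} [AddCommGroup V] [Module K V]

/-- The action of the group ring over `O` on a representation over the `O`-algebra `K`. -/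
noncomputable def Representation.integralHom (O : Type*) [CommRing O] [Algebra O K]
    (ρ : Representation K G V) : O[G] →+* Module.End K V :=
  ρ.asAlgebraHom.toRingHom.comp (MonoidAlgebra.mapRingHom G (algebraMap O K))

theorem Representation.integralHom_smul (ρ : Representation K G V) (r : O) (x : O[G]) :
    ρ.integralHom O (r • x) = algebraMap O K r • ρ.integralHom O x := by
  change ρ.asAlgebraHom _ = _ • ρ.asAlgebraHom _
  rw [MonoidAlgebra.mapRingHom_smul, map_smul]

theorem Representation.character_eq_of_asModule_equiv {W : Type*} [AddCommGroup W] [Module K W]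
    {ρ : Representation K G V} {σ : Representation K G W}
    (e : ρ.asModule ≃ₗ[K[G]] σ.asModule) : ρ.character = σ.character :=
  Representation.char_iso (Representation.IntertwiningMap.ofBijective
    ((Representation.IntertwiningMap.equivLinearMapAsModule ρ σ).symm e.toLinearMap) e.bijective)

/-- Denominators of an element of `K[G]` can be cleared. -/
theorem MonoidAlgebra.exists_integer_multiple [IsDomain O] [IsFractionRing O K] (z : K[G]) :
    ∃ (s : O) (y : O[G]), s ≠ 0 ∧
      MonoidAlgebra.mapRingHom G (algebraMap O K) y = algebraMap O K s • z := by
  obtain ⟨s, hs⟩ := IsLocalization.exist_integer_multiples (nonZeroDivisors O) z.coeff.support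
    (fun g => z.coeff g)
  choose! r hr using hs
  refine ⟨s, ∑ g ∈ z.coeff.support, MonoidAlgebra.single g (r g), nonZeroDivisors.ne_zero s.2, ?_⟩
  classical
  ext g
  by_cases hg : z.coeff g = 0
  · simp [Finsupp.single_apply, hg]
  · have := hr g (Finsupp.mem_support_iff.mpr hg)
    simp [Finsupp.single_apply, hg, this, Algebra.smul_def]

/-- Pairwise non-isomorphic irreducible representations on which an idempotent `e` of the integral
group ring does not vanish yield linearly independent elements of the corner of `e`: the `i`-th
one acts as a multiple of `e` on the `i`-th representation, and as zero on the others. -/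
theorem exists_linearIndependent_of_integralHom_ne_zero [IsDomain O] [IsFractionRing O K]
    [Finite G] [CharZero K] {ι : Type*} [Fintype ι] {n : ι → ℕ}
    (ρ : ∀ i, Representation K G (Fin (n i) → K)) (hirr : ∀ i, (ρ i).IsIrreducible)
    (hρ : Function.Injective fun i => (ρ i).character) {e : O[G]} (he : e * e = e)
    (hne : ∀ i, (ρ i).integralHom O e ≠ 0) :
    ∃ v : ι → O[G], LinearIndependent O v ∧ ∀ i, e * v i * e = v i := by
  have hsimple : ∀ i, IsSimpleModule K[G] (ρ i).asModule := fun i =>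
    (Representation.irreducible_iff_isSimpleModule_asModule _).mp (hirr i)
  choose z hz1 hz0 using exists_smul_eq_of_pairwise_not_iso (A := K[G])
    (V := fun i => (ρ i).asModule) fun i j hij =>
      ⟨fun f => hij (hρ (Representation.character_eq_of_asModule_equiv f))⟩
  have hz1' : ∀ i, (ρ i).asAlgebraHom (z i) = 1 := fun i => LinearMap.ext fun x => hz1 i x
  have hz0' : ∀ i j, j ≠ i → (ρ j).asAlgebraHom (z i) = 0 := fun i j h =>
    LinearMap.ext fun x => hz0 i j h x
  choose s y hs hy using fun i => MonoidAlgebra.exists_integer_multiple (O := O) (z i)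
  have hint : ∀ i j, (ρ j).integralHom O (y i) =
      algebraMap O K (s i) • (ρ j).asAlgebraHom (z i) := fun i j => by
    change (ρ j).asAlgebraHom _ = _
    rw [hy, map_smul]
  have hidem : ∀ i, e * (e * y i * e) * e = e * y i * e := fun i => by
    calc e * (e * y i * e) * e = (e * e) * y i * (e * e) := by noncomm_ring
      _ = e * y i * e := by rw [he]
  refine ⟨fun i => e * y i * e, ?_, hidem⟩
  rw [Fintype.linearIndependent_iff]
  intro a ha j
  have h1 := congrArg ((ρ j).integralHom O) ha
  rw [map_zero, map_sum, Finset.sum_eq_single j] at h1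
  · rw [Representation.integralHom_smul, map_mul, map_mul, hint, hz1', mul_smul_comm, mul_one,
      smul_mul_assoc, ← map_mul, he, smul_smul, ← map_mul] at h1
    have h2 := (smul_eq_zero.mp h1).resolve_right (hne j)
    rw [FaithfulSMul.algebraMap_eq_zero_iff] at h2
    exact (mul_eq_zero.mp h2).resolve_right (hs j)
  · intro i _ hij
    rw [Representation.integralHom_smul, map_mul, map_mul, hint, hz0' i j hij.symm]
    simp
  · simp

end Ordinary

/-- If the reductions of the elements `e i` of `O[G]` generate an ideal containing the block
idempotent `b`, then on a representation in the block some `e i` does not vanish. -/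
theorem BlockTheory.BelongsToBlock.exists_integralHom_ne_zero {O : Type*} [CommRing O] [IsDomain O]
    [IsDiscreteValuationRing O] {K : Type*} [Field K] [Algebra O K] [IsFractionRing O K]
    {G : Type*} [Group G] [Finite G] {V : Type*} [AddCommGroup V] [Module K V] [Nontrivial V]
    {b : (IsLocalRing.ResidueField O)[G]} {ρ : Representation K G V} (hρ : BelongsToBlock O b ρ)
    {ι : Type*} (e : ι → O[G])
    (he : ∀ J : TwoSidedIdeal (IsLocalRing.ResidueField O)[G],
      (∀ i, MonoidAlgebra.mapRingHom G (IsLocalRing.residue O) (e i) ∈ J) → b ∈ J) :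
    ∃ i, ρ.integralHom O (e i) ≠ 0 := by
  by_contra! h0
  obtain ⟨c, -, -, hcb, hc1⟩ := hρ
  set φ := MonoidAlgebra.mapRingHom G (IsLocalRing.residue O) with hφ
  have hφs : Function.Surjective φ :=
    MonoidAlgebra.mapRingHom_surjective IsLocalRing.residue_surjective
  -- the reduction of the annihilator of `V` is a two-sided ideal, hence contains `b`
  let J : TwoSidedIdeal (IsLocalRing.ResidueField O)[G] :=
    TwoSidedIdeal.mk' (φ '' {x | ρ.integralHom O x = 0}) ⟨0, by simp, map_zero _⟩
      (by
        rintro _ _ ⟨x, hx, rfl⟩ ⟨y, hy, rfl⟩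
        rw [Set.mem_ofPred_eq] at hx hy
        exact ⟨x + y, by rw [Set.mem_ofPred_eq, map_add, hx, hy, add_zero], map_add _ _ _⟩)
      (by
        rintro _ ⟨x, hx, rfl⟩
        rw [Set.mem_ofPred_eq] at hx
        exact ⟨-x, by rw [Set.mem_ofPred_eq, map_neg, hx, neg_zero], map_neg _ _⟩)
      (by
        rintro r _ ⟨y, hy, rfl⟩
        obtain ⟨x, rfl⟩ := hφs r
        rw [Set.mem_ofPred_eq] at hy
        exact ⟨x * y, by rw [Set.mem_ofPred_eq, map_mul, hy, mul_zero], map_mul _ _ _⟩)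
      (by
        rintro _ r ⟨x, hx, rfl⟩
        obtain ⟨y, rfl⟩ := hφs r
        rw [Set.mem_ofPred_eq] at hx
        exact ⟨x * y, by rw [Set.mem_ofPred_eq, map_mul, hx, zero_mul], map_mul _ _ _⟩)
  have hb : b ∈ J := he J fun i => (TwoSidedIdeal.mem_mk' _ _ _ _ _ _ _).mpr ⟨e i, h0 i, rfl⟩
  obtain ⟨y, hy, hyb⟩ := (TwoSidedIdeal.mem_mk' _ _ _ _ _ _ _).mp hb
  obtain ⟨ϖ, hϖ⟩ := IsDiscreteValuationRing.exists_irreducible O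
  have hmax := hϖ.maximalIdeal_eq
  obtain ⟨w, hw⟩ := (MonoidAlgebra.mapRingHom_residue_eq_zero_iff hmax (c - y)).mp
    (by rw [map_sub, hcb, ← hφ, hyb, sub_self])
  -- so the identity is `ϖ` times the action of `w`, and `ϖ⁻¹` is integral over `O`
  have h1 : algebraMap O K ϖ • ρ.integralHom O w = 1 := by
    rw [← Representation.integralHom_smul, ← hw, map_sub, hy, sub_zero]
    exact hc1
  have hϖ0 : algebraMap O K ϖ ≠ 0 := by
    rw [Ne, FaithfulSMul.algebraMap_eq_zero_iff]
    exact hϖ.ne_zero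
  have h2 : ρ.integralHom O w = algebraMap K (Module.End K V) (algebraMap O K ϖ)⁻¹ := by
    rw [Algebra.algebraMap_eq_smul_one, ← h1, smul_smul, inv_mul_cancel₀ hϖ0, one_smul]
  obtain ⟨P, hP, hPw⟩ := IsIntegral.of_finite O w
  have h3 : IsIntegral O (algebraMap O K ϖ)⁻¹ := by
    refine ⟨P, hP, (algebraMap K (Module.End K V)).injective ?_⟩
    rw [map_zero, Polynomial.hom_eval₂, ← h2]
    have h4 := congrArg (ρ.integralHom O) hPw
    rw [map_zero, Polynomial.hom_eval₂] at h4
    rw [← h4]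
    congr 1
    ext r : 1
    have := ρ.integralHom_smul r (1 : O[G])
    rw [map_one, ← Algebra.algebraMap_eq_smul_one, ← Algebra.algebraMap_eq_smul_one] at this
    exact this.symm
  obtain ⟨u, hu⟩ := IsIntegrallyClosed.isIntegral_iff.mp h3
  apply hϖ.not_isUnit
  refine IsUnit.of_mul_eq_one u (FaithfulSMul.algebraMap_injective O K ?_)
  rw [map_mul, hu, mul_inv_cancel₀ hϖ0, map_one]

/-! ### The bound for the number of characters of a block -/

theorem mainTheorem4 (p : ℕ) [Fact p.Prime] (G : Type*) [Group G] [Finite G]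
    (O : Type*) [CommRing O] [IsDomain O] [IsDiscreteValuationRing O]
    [IsAdicComplete (IsLocalRing.maximalIdeal O) O]
    (K : Type*) [Field K] [Algebra O K] [IsFractionRing O K] [CharZero K]
    [CharP (IsLocalRing.ResidueField O) p]
    (hK : BlockTheory.IsSplittingFieldFor K G)
    (hF : BlockTheory.IsSplittingFieldFor (IsLocalRing.ResidueField O) G)
    (b : MonoidAlgebra (IsLocalRing.ResidueField O) G) (hb : BlockTheory.IsBlockIdempotent b) :
    (BlockTheory.blockCharacters O K b).Finite ∧
      (BlockTheory.blockCharacters O K b).ncard ≤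
        (BlockTheory.cartanMatrix (BlockTheory.BlockAlgebra hb)ᵐᵒᵖ).trace := by
  classical
  obtain ⟨f, hf, hdim, hgen⟩ := BlockTheory.exists_block_idempotents hb hF
  obtain ⟨ϖ, hϖ⟩ := IsDiscreteValuationRing.exists_irreducible O
  have hmax := hϖ.maximalIdeal_eq
  have hlift : ∀ S, ∃ e : O[G], e * e = e ∧
      MonoidAlgebra.mapRingHom G (IsLocalRing.residue O) e = f S := by
    intro S
    obtain ⟨a, ha⟩ := MonoidAlgebra.mapRingHom_surjective (G := G)
      (IsLocalRing.residue_surjective (R := O)) (f S)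
    obtain ⟨y, hy⟩ := (MonoidAlgebra.mapRingHom_residue_eq_zero_iff hmax (a * a - a)).mp
      (by rw [map_sub, map_mul, ha, hf, sub_self])
    have : IsAdicComplete (Ideal.span {ϖ}) O := hmax ▸ inferInstance
    obtain ⟨e, he, z, hz⟩ := exists_idempotent_lift ϖ hy
    refine ⟨e, he, ?_⟩
    rw [hz, map_add, ha, (MonoidAlgebra.mapRingHom_residue_eq_zero_iff hmax (ϖ • z)).mpr ⟨z, rfl⟩,
      add_zero]
  choose e he hef using hlift
  choose! n ρ hirr hbel hchar using fun χ (hχ : χ ∈ BlockTheory.blockCharacters O K b) => hχ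
  -- finiteness of the set of characters is not known yet, so bound its finite subsets
  have hcard : ∀ T : Finset (G → K), (T : Set (G → K)) ⊆ BlockTheory.blockCharacters O K b →
      T.card ≤ (BlockTheory.cartanMatrix (BlockTheory.BlockAlgebra hb)ᵐᵒᵖ).trace := by
    intro T hT
    have hcover : T ⊆ Finset.univ.biUnion fun S => {χ ∈ T | (ρ χ).integralHom O (e S) ≠ 0} := by
      intro χ hχ
      have : IsSimpleModule K[G] (ρ χ).asModule :=
        (Representation.irreducible_iff_isSimpleModule_asModule _).mp (hirr χ (hT hχ))
      have : Nontrivial (Fin (n χ) → K) := IsSimpleModule.nontrivial K[G] (ρ χ).asModule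
      obtain ⟨S, hS⟩ := (hbel χ (hT hχ)).exists_integralHom_ne_zero e
        fun J hJ => hgen J fun S => hef S ▸ hJ S
      exact Finset.mem_biUnion.mpr ⟨S, Finset.mem_univ S, Finset.mem_filter.mpr ⟨hχ, hS⟩⟩
    refine (Finset.card_le_card hcover).trans (Finset.card_biUnion_le.trans ?_)
    refine Finset.sum_le_sum fun S _ => ?_
    obtain ⟨d, w, hw, hwli, hwmax⟩ := exists_linearIndependent_corner (he S)
    obtain ⟨v, hv, hve⟩ := exists_linearIndependent_of_integralHom_ne_zero (O := O)
      (ι := {χ // χ ∈ T.filter fun χ => (ρ χ).integralHom O (e S) ≠ 0}) (fun χ => ρ χ.1)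
      (fun χ => hirr χ.1 (hT (Finset.mem_filter.mp χ.2).1))
      (fun χ ψ h => Subtype.ext (by
        have h' : (ρ χ.1).character = (ρ ψ.1).character := h
        rwa [hchar χ.1 (hT (Finset.mem_filter.mp χ.2).1),
          hchar ψ.1 (hT (Finset.mem_filter.mp ψ.2).1)] at h'))
      (he S) fun χ => (Finset.mem_filter.mp χ.2).2
    rw [← Fintype.card_coe]
    refine (hwmax v hv hve).trans (hdim S d _ hwli fun i => ?_)
    rw [← hef, ← map_mul, ← map_mul, hw]
  have hfin : (BlockTheory.blockCharacters O K b).Finite := by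
    by_contra hinf
    obtain ⟨T, hT, hTc⟩ := Set.Infinite.exists_subset_card_eq hinf
      ((BlockTheory.cartanMatrix (BlockTheory.BlockAlgebra hb)ᵐᵒᵖ).trace + 1)
    have := hcard T hT
    omega
  refine ⟨hfin, ?_⟩
  rw [Set.ncard_eq_toFinset_card _ hfin]
  exact hcard _ (by simp)
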